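/- Let $K$ be a number field with precisely one prime $\mathfrak{P}$ above $2$, and let $S=\{\mathfrak{P}\}$. Let $\mathcal{O}_S^\times=\{\alpha\in K^\times : \operatorname{ord}_{\mathfrak q}(\alpha)=0 \text{ for all finite primes } \mathfrak q\ne\mathfrak P\}$ be the group of $S$-units, and consider the $S$-unit equation \[ \lambda+\mu=1,\qquad \lambda,\mu\in\mathcal{O}_S^\times. \qquad (*) \] The following are equivalent. (i) There is an elliptic curve $E/K$ with full $2$-torsion (that is, $E[2]\subseteq E(K)$) and conductor $\mathfrak{P}$. (ii) There is an elliptic curve $E/K$ with full $2$-torsion, potentially good reduction at every finite prime of $K$ other than $\mathfrak{P}$, and potentially multiplicative reduction at $\mathfrak{P}$. (iii) There is a solution $(\lambda,\mu)$ to $(*)$ with $\operatorname{ord}_{\mathfrak P}(\mu)=0$ and $\operatorname{ord}_{\mathfrak P}(\lambda)>4\operatorname{ord}_{\mathfrak P}(2)$. (iv) There is a solution $(\lambda,\mu)$ to $(*)$ with $\max\{|\operatorname{ord}_{\mathfrak P}(\lambda)|,|\operatorname{ord}_{\mathfrak P}(\mu)|\}>4\operatorname{ord}_{\mathfrak P}(2)$.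 -/

import Mathlib

open IsDedekindDomain NumberField

universe u

noncomputable section

namespace FermatTwist

/-! ### Valuations and the `S`-unit equation -/

/-- The normalised additive valuation `ord_v(x) ∈ ℤ` of a nonzero element `x` of a number field
(with the convention `ord_v(0) = 0`, which is never used). -/
def ordAt {K : Type u} [Field K] [NumberField K] (v : HeightOneSpectrum (𝓞 K)) (x : K) : ℤ :=
  -WithZero.log (v.valuation K x)

/-- `(x, y)` solves the `S`-unit equation `x + y = 1`, with `x` and `y` both `S`-units of `K`. -/
def IsSUnitSolution {K : Type u} [Field K] [NumberField K] (S : Set (HeightOneSpectrum (𝓞 K)))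
    (x y : Kˣ) : Prop :=
  x ∈ S.unit K ∧ y ∈ S.unit K ∧ (x : K) + (y : K) = 1

/-! ### Reduction types at a finite place -/

/-- `E` has good reduction at `v`: over the completion `K_v`, some minimal Weierstrass model of `E`
has good reduction. -/
def HasGoodReductionAt {K : Type u} [Field K] [NumberField K] (E : WeierstrassCurve K)
    (v : HeightOneSpectrum (𝓞 K)) : Prop :=
  ∃ C : WeierstrassCurve.VariableChange (v.adicCompletion K),
    (C • E.baseChange (v.adicCompletion K)).HasGoodReduction (v.adicCompletionIntegers K)

/-- `E` has (split or nonsplit) multiplicative reduction at `v`: over the completion `K_v`, some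
minimal Weierstrass model of `E` has multiplicative reduction. -/
def HasMultiplicativeReductionAt {K : Type u} [Field K] [NumberField K] (E : WeierstrassCurve K)
    (v : HeightOneSpectrum (𝓞 K)) : Prop :=
  ∃ C : WeierstrassCurve.VariableChange (v.adicCompletion K),
    (C • E.baseChange (v.adicCompletion K)).HasMultiplicativeReduction (v.adicCompletionIntegers K)

/-- `E` has potentially good reduction at `v`: it acquires good reduction at a place `w` above `v`
of some finite extension `L / K`. -/
def HasPotentiallyGoodReductionAt {K : Type u} [Field K] [NumberField K] (E : WeierstrassCurve K)
    (v : HeightOneSpectrum (𝓞 K)) : Prop :=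
  ∃ (L : Type u) (_ : Field L) (_ : NumberField L) (_ : Algebra K L)
    (w : HeightOneSpectrum (𝓞 L)),
    w.asIdeal.LiesOver v.asIdeal ∧ HasGoodReductionAt (E.baseChange L) w

/-- `E` has potentially multiplicative reduction at `v`: it acquires multiplicative reduction at a
place `w` above `v` of some finite extension `L / K`. -/
def HasPotentiallyMultiplicativeReductionAt {K : Type u} [Field K] [NumberField K]
    (E : WeierstrassCurve K) (v : HeightOneSpectrum (𝓞 K)) : Prop :=
  ∃ (L : Type u) (_ : Field L) (_ : NumberField L) (_ : Algebra K L)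
    (w : HeightOneSpectrum (𝓞 L)),
    w.asIdeal.LiesOver v.asIdeal ∧ HasMultiplicativeReductionAt (E.baseChange L) w

/-! ### Torsion -/

open scoped Classical in
/-- `E / K` has full `2`-torsion: every geometric point killed by `2` is `K`-rational,
that is, `E[2] ⊆ E(K)`. -/
def HasFullTwoTorsion {K : Type u} [Field K] (E : WeierstrassCurve K) : Prop :=
  ∀ Q : (E.baseChange (AlgebraicClosure K)).toAffine.Point, 2 • Q = 0 →
    ∃ P : (E.baseChange K).toAffine.Point,
      WeierstrassCurve.Affine.Point.map (W' := E) (S := K)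
        (Algebra.ofId K (AlgebraicClosure K)) P = Q

open scoped Classical in
/-- The `n`-division field `K(E[n])`: the extension of `K` generated by the coordinates of all
nonzero `n`-torsion points of `E` over an algebraic closure. -/
def divisionField {K : Type u} [Field K] (E : WeierstrassCurve K) (n : ℕ) :
    IntermediateField K (AlgebraicClosure K) :=
  IntermediateField.adjoin K
    {t | ∃ (x y : AlgebraicClosure K)
      (h : (E.baseChange (AlgebraicClosure K)).toAffine.Nonsingular x y),
      n • (WeierstrassCurve.Affine.Point.some x y h) = 0 ∧ (t = x ∨ t = y)}

open scoped Classical in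
/-- The group `E(L)[n]` of `n`-torsion points over an extension `L / K`. -/
def torsion {K : Type u} [Field K] (E : WeierstrassCurve K) (L : Type u) [Field L] [Algebra K L]
    (n : ℕ) : AddSubgroup (E.baseChange L).toAffine.Point where
  carrier := {P | n • P = 0}
  zero_mem' := smul_zero n
  add_mem' {P Q} hP hQ := by
    simp only [Set.mem_ofPred_eq] at hP hQ ⊢
    rw [smul_add, hP, hQ, add_zero]
  neg_mem' {P} hP := by
    simp only [Set.mem_ofPred_eq] at hP ⊢
    rw [smul_neg, hP, neg_zero]

open scoped Classical in
/-- The points of `E(L)` fixed by a group `H` of automorphisms of `L / K`. -/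
def fixedPoints {K : Type u} [Field K] (E : WeierstrassCurve K) (L : Type u) [Field L]
    [Algebra K L] (H : Subgroup (L ≃ₐ[K] L)) :
    AddSubgroup (E.baseChange L).toAffine.Point where
  carrier := {P | ∀ σ ∈ H,
    WeierstrassCurve.Affine.Point.map (W' := E) (S := K) (σ : L →ₐ[K] L) P = P}
  zero_mem' := fun σ _ ↦ _root_.map_zero _
  add_mem' {P Q} hP hQ σ hσ := by rw [map_add, hP σ hσ, hQ σ hσ]
  neg_mem' {P} hP σ hσ := by rw [map_neg, hP σ hσ]

/-! ### The conductor -/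

/-- The `i`-th ramification group (lower numbering) of `L / K` at the prime `𝔔` of `L`:
the automorphisms acting trivially on `𝓞 L / 𝔔 ^ (i + 1)`. -/
def ramificationGroup (K : Type u) {L : Type u} [Field K] [Field L] [Algebra K L]
    (𝔔 : Ideal (𝓞 L)) (i : ℕ) : Subgroup (L ≃ₐ[K] L) :=
  (𝔔 ^ (i + 1)).inertia (L ≃ₐ[K] L)

open scoped Classical in
/-- `dim_{𝔽_ℓ} E[ℓ] / E[ℓ]^H` for a prime `ℓ`, a group `H` of automorphisms of `L / K`, and an
extension `L` of `K` over which `E[ℓ]` is rational. The quotient is an `𝔽_ℓ`-vector space, of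
cardinality the index of `E[ℓ]^H` in `E[ℓ]`, so its dimension is the logarithm of that index to
the base `ℓ`. -/
def codimFixed {K : Type u} [Field K] (E : WeierstrassCurve K) (L : Type u) [Field L]
    [Algebra K L] (l : ℕ) (H : Subgroup (L ≃ₐ[K] L)) : ℕ :=
  Nat.log l ((fixedPoints E L H).relIndex (torsion E L l))

/-- The prime `ℓ` whose torsion is used to define the conductor exponent at `v`: the smallest prime
different from the residue characteristic of `v`. -/
def auxPrime {K : Type u} [Field K] [NumberField K] (v : HeightOneSpectrum (𝓞 K)) : ℕ :=
  open scoped Classical in if (2 : 𝓞 K) ∈ v.asIdeal then 3 else 2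

/-- A prime of the division field `K(E[ℓ])` above `v`. All of them are conjugate. -/
def primeAbove {K : Type u} [Field K] [NumberField K] (E : WeierstrassCurve K)
    (v : HeightOneSpectrum (𝓞 K)) (l : ℕ) : Ideal (𝓞 (divisionField E l)) :=
  (Classical.arbitrary (v.asIdeal.primesOver (𝓞 (divisionField E l)))).1

/-- The wild part `δ_v(E) = ∑_{i ≥ 1} (#G_i / #G_0) · dim_{𝔽_ℓ} (E[ℓ] / E[ℓ]^{G_i})` of the
conductor exponent, where `ℓ` is a prime different from the residue characteristic of `v` and the
`G_i` are the ramification groups above `v` of `K(E[ℓ]) / K`. The sum is finite, and it is an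
integer, so that the division of natural numbers below is exact. -/
def wildExponent {K : Type u} [Field K] [NumberField K] (E : WeierstrassCurve K)
    (v : HeightOneSpectrum (𝓞 K)) : ℕ :=
  let l : ℕ := auxPrime v
  let G : ℕ → Subgroup (divisionField E l ≃ₐ[K] divisionField E l) :=
    fun i ↦ ramificationGroup K (primeAbove E v l) i
  (∑ᶠ i : ℕ, Nat.card (G (i + 1)) * codimFixed E (divisionField E l) l (G (i + 1))) /
    Nat.card (G 0)

open scoped Classical in
/-- The exponent of the conductor of `E` at `v`: `0` for good reduction, `1` for multiplicative
reduction, and `2 + δ_v(E)` for additive reduction. -/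
def conductorExponent {K : Type u} [Field K] [NumberField K] (E : WeierstrassCurve K)
    (v : HeightOneSpectrum (𝓞 K)) : ℕ :=
  if HasGoodReductionAt E v then 0
  else if HasMultiplicativeReductionAt E v then 1
  else 2 + wildExponent E v

/-- The conductor of an elliptic curve `E` over a number field `K`, an ideal of `𝓞 K`.
Only the finitely many places of bad reduction contribute to the product. -/
def conductor {K : Type u} [Field K] [NumberField K] (E : WeierstrassCurve K) : Ideal (𝓞 K) :=
  ∏ᶠ v : HeightOneSpectrum (𝓞 K), v.asIdeal ^ conductorExponent E v

end FermatTwist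

end

namespace FermatTwist

/-! ### Valuations of discrete valuation rings, completions and extensions -/

section Valuations

/-! Full 2-torsion gives `E` a Legendre parameter `l` in `K`, with `j * l² * (1 - l)² = 2⁸ * (l² - l
+ 1)³` (`exists_legendre`). Potentially good reduction at `v` forces `j` to be `v`-integral,
potentially multiplicative reduction forces it not to be. Away from `P`, 2 is a unit, so integrality
of `j` makes `l` and `1 - l` units (`valuation_legendre_eq_one`): `(l, 1 - l)` is a solution. At
`P`, a large `l` gives `|j| = (|2|⁴ |l|)²`, so non-integrality of `j` places one of `l`, `1 - l`,
`l⁻¹` below `|2|⁴` (`legendre_trichotomy`); this is the origin of the bound `4 ord(2)`. Swapping and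
inverting solutions moves the small term to `λ`. Conversely, if `ord(λ) > 4 ord(2)`, the model
`freyCurve λ` is integral everywhere, with unit discriminant away from `P`, and with unit `c₄` and
non-unit discriminant at `P`. Only the conductor exponents 0 and 1 occur, so the wild part is never
evaluated. -/

lemma valuation_maximalIdeal_le_one_iff (R : Type*) [CommRing R] [IsDomain R]
    [IsDiscreteValuationRing R] {F : Type*} [Field F] [Algebra R F] [IsFractionRing R F] (x : F) :
    (IsDiscreteValuationRing.maximalIdeal R).valuation F x ≤ 1 ↔ ∃ r, algebraMap R F r = x := by
  constructor
  · intro h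
    obtain ⟨n, d, hnd⟩ := HeightOneSpectrum.exists_primeCompl_mul_eq_of_integer _ x h
    obtain ⟨d', hd'⟩ : IsUnit (d : R) := by
      by_contra hd
      exact d.2 ((IsLocalRing.mem_maximalIdeal _).2 hd)
    refine ⟨n * ↑d'⁻¹, ?_⟩
    rw [map_mul, ← hnd, ← hd', mul_assoc, ← map_mul, Units.mul_inv, map_one, mul_one]
  · rintro ⟨r, rfl⟩
    exact HeightOneSpectrum.valuation_le_one _ r

section Comparison

variable {F F' : Type*} [Field F] [Field F'] {Γ Γ' : Type*} [LinearOrderedCommGroupWithZero Γ]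
  [LinearOrderedCommGroupWithZero Γ'] (w : Valuation F Γ) (w' : Valuation F' Γ') (f : F →+* F')

include w w' f

/-- The value groups differ, so valuations are compared only through integrality; applying `h` to
`x⁻¹` yields the strict version. -/
lemma map_valuation_lt_one_iff (h : ∀ x, w' (f x) ≤ 1 ↔ w x ≤ 1) (x : F) :
    w' (f x) < 1 ↔ w x < 1 := by
  rcases eq_or_ne x 0 with rfl | hx
  · simp
  have hw : 0 < w x := zero_lt_iff.2 ((w.ne_zero_iff).2 hx)
  have hw' : 0 < w' (f x) := zero_lt_iff.2 ((w'.ne_zero_iff).2 ((map_ne_zero f).2 hx))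
  have := h x⁻¹
  rw [map_inv₀, map_inv₀, map_inv₀, inv_le_one₀ hw', inv_le_one₀ hw] at this
  simpa using not_congr this

lemma map_valuation_eq_one_iff (h : ∀ x, w' (f x) ≤ 1 ↔ w x ≤ 1) (x : F) :
    w' (f x) = 1 ↔ w x = 1 := by
  have h1 := h x
  have h2 := map_valuation_lt_one_iff w w' f h x
  constructor
  · intro hx
    exact le_antisymm (h1.1 hx.le) (not_lt.1 (mt h2.2 hx.not_lt))
  · intro hx
    exact le_antisymm (h1.2 hx.le) (not_lt.1 (mt h2.1 hx.not_lt))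

end Comparison

variable {K : Type*} [Field K] [NumberField K] (v : HeightOneSpectrum (𝓞 K))

lemma valuation_adicCompletion_le_one_iff (x : K) :
    (IsDiscreteValuationRing.maximalIdeal (v.adicCompletionIntegers K)).valuation
      (v.adicCompletion K) (algebraMap K (v.adicCompletion K) x) ≤ 1 ↔ v.valuation K x ≤ 1 := by
  rw [valuation_maximalIdeal_le_one_iff, ← v.valuedAdicCompletion_eq_valuation',
    ← HeightOneSpectrum.mem_adicCompletionIntegers]
  constructor
  · rintro ⟨r, hr⟩
    have := r.2
    rw [show (r : v.adicCompletion K) = _ from hr] at this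
    exact this
  · intro h
    exact ⟨⟨_, h⟩, rfl⟩

/-- Ramification rescales values but preserves their position relative to 1. An integral `x` is `n /
d` with `d` outside `v`, and lying over controls both `n` and `d`; a non-integral `x` is handled
through `x⁻¹`. -/
lemma valuation_algebraMap_le_one_iff {L : Type*} [Field L] [NumberField L] [Algebra K L]
    (w : HeightOneSpectrum (𝓞 L)) [hw : w.asIdeal.LiesOver v.asIdeal] (x : K) :
    w.valuation L (algebraMap K L x) ≤ 1 ↔ v.valuation K x ≤ 1 := by
  have key (a : 𝓞 K) : w.valuation L (algebraMap K L (algebraMap (𝓞 K) K a)) < 1 ↔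
      a ∈ v.asIdeal := by
    rw [← IsScalarTower.algebraMap_apply (𝓞 K) K L, IsScalarTower.algebraMap_apply (𝓞 K) (𝓞 L) L,
      HeightOneSpectrum.valuation_lt_one_iff_mem, Ideal.mem_of_liesOver w.asIdeal v.asIdeal]
  have key' (a : 𝓞 K) : w.valuation L (algebraMap K L (algebraMap (𝓞 K) K a)) ≤ 1 := by
    rw [← IsScalarTower.algebraMap_apply (𝓞 K) K L, IsScalarTower.algebraMap_apply (𝓞 K) (𝓞 L) L]
    exact w.valuation_le_one _
  have main {x : K} (hx : v.valuation K x ≤ 1) : w.valuation L (algebraMap K L x) ≤ 1 ∧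
      (v.valuation K x < 1 → w.valuation L (algebraMap K L x) < 1) := by
    obtain ⟨n, d, h⟩ := v.exists_primeCompl_mul_eq_of_integer x hx
    have hd : w.valuation L (algebraMap K L (algebraMap (𝓞 K) K d)) = 1 :=
      le_antisymm (key' d) (not_lt.1 fun h ↦ d.2 ((key d).1 h))
    have hd' : v.valuation K (algebraMap (𝓞 K) K d) = 1 :=
      v.valuation_eq_one_iff_notMem.2 d.2
    have hn : w.valuation L (algebraMap K L x) =
        w.valuation L (algebraMap K L (algebraMap (𝓞 K) K n)) := by
      rw [← h, map_mul, map_mul, hd, mul_one]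
    have hn' : v.valuation K x = v.valuation K (algebraMap (𝓞 K) K n) := by
      rw [← h, map_mul, hd', mul_one]
    rw [hn, hn']
    exact ⟨key' n, fun h ↦ (key n).2 ((v.valuation_lt_one_iff_mem n).1 h)⟩
  refine ⟨fun h ↦ ?_, fun h ↦ (main h).1⟩
  by_contra! hx
  have hx0 : x ≠ 0 := by
    rintro rfl
    simp at hx
  have h1 : v.valuation K x⁻¹ < 1 := by
    rw [map_inv₀]
    exact inv_lt_one_of_one_lt₀ hx
  have h2 := (main h1.le).2 h1
  rw [map_inv₀, map_inv₀, inv_lt_one₀ (zero_lt_iff.2 (by simpa using hx0))] at h2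
  exact absurd h h2.not_ge

end Valuations

/-! ### Reduction types -/

section Reduction

open WeierstrassCurve

/-- Invariance of `j`, written as a quotient so that no `IsElliptic` instance is carried along:
numerator and denominator both scale by `u⁻¹²`. -/
lemma variableChange_c₄_cube_div_Δ {F : Type*} [Field F] (W : WeierstrassCurve F)
    (C : VariableChange F) : (C • W).c₄ ^ 3 / (C • W).Δ = W.c₄ ^ 3 / W.Δ := by
  rw [variableChange_c₄, variableChange_Δ, mul_pow, ← pow_mul]
  exact mul_div_mul_left _ _ (pow_ne_zero _ (Units.ne_zero _))

variable (R : Type*) [CommRing R] [IsDomain R]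
    [IsDiscreteValuationRing R] {F : Type*} [Field F] [Algebra R F] [IsFractionRing R F]
    (W : WeierstrassCurve F)

lemma valuation_c₄_le_one [W.IsIntegral R] :
    (IsDiscreteValuationRing.maximalIdeal R).valuation F W.c₄ ≤ 1 := by
  rw [← integralModel_c₄_eq R W]
  exact HeightOneSpectrum.valuation_le_one _ _

lemma valuation_Δ_le_one [W.IsIntegral R] :
    (IsDiscreteValuationRing.maximalIdeal R).valuation F W.Δ ≤ 1 := by
  rw [← integralModel_Δ_eq R W]
  exact HeightOneSpectrum.valuation_le_one _ _

lemma valuation_j_le_one_of_hasGoodReduction (h : W.HasGoodReduction R) :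
    (IsDiscreteValuationRing.maximalIdeal R).valuation F (W.c₄ ^ 3 / W.Δ) ≤ 1 := by
  rw [map_div₀, h.goodReduction, div_one, map_pow]
  exact pow_le_one' (valuation_c₄_le_one R W) 3

/-- `hΔ` excludes the nodal cubic, for which the quotient would take the default value 0. -/
lemma one_lt_valuation_j_of_hasMultiplicativeReduction (hΔ : W.Δ ≠ 0)
    (h : W.HasMultiplicativeReduction R) :
    1 < (IsDiscreteValuationRing.maximalIdeal R).valuation F (W.c₄ ^ 3 / W.Δ) := by
  rw [map_div₀, map_pow, h.multiplicativeReduction, one_pow, one_div]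
  exact (one_lt_inv₀ (zero_lt_iff.2 (by simpa using hΔ))).2 h.badReduction

lemma isMinimal_of_forall_valuation_Δ_le [hW : W.IsIntegral R]
    (h : ∀ C : VariableChange F, (C • W).IsIntegral R →
      (IsDiscreteValuationRing.maximalIdeal R).valuation F (C • W).Δ ≤
        (IsDiscreteValuationRing.maximalIdeal R).valuation F W.Δ) :
    W.IsMinimal R := by
  refine ⟨⟨by simpa using hW, fun C hC _ ↦ ?_⟩⟩
  rw [← Subtype.coe_le_coe]
  have h1 : (1 : VariableChange F) • W = W := one_smul _ _
  simp only [h1]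
  have hC' : (C • W).IsIntegral R := hC
  rw [valuation_Δ_aux_eq_of_isIntegral R W, valuation_Δ_aux_eq_of_isIntegral R (C • W)]
  exact h C hC'

lemma hasGoodReduction_of_valuation_Δ_eq_one [W.IsIntegral R]
    (hΔ : (IsDiscreteValuationRing.maximalIdeal R).valuation F W.Δ = 1) :
    W.HasGoodReduction R :=
  { isMinimal_of_forall_valuation_Δ_le R W fun C _ ↦ hΔ.symm ▸ valuation_Δ_le_one R (C • W) with
    goodReduction := hΔ }

/-- A unit `c₄` certifies minimality: integrality of `u⁻⁴ c₄` forces `u⁻¹` to be integral, so the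
factor `u⁻¹²` cannot enlarge the valuation of the discriminant. -/
lemma hasMultiplicativeReduction_of_valuation_c₄_eq_one [W.IsIntegral R]
    (hΔ : (IsDiscreteValuationRing.maximalIdeal R).valuation F W.Δ < 1)
    (hc : (IsDiscreteValuationRing.maximalIdeal R).valuation F W.c₄ = 1) : W.HasMultiplicativeReduction R :=
  { isMinimal_of_forall_valuation_Δ_le R W fun C _ ↦ by
      have h := valuation_c₄_le_one R (C • W)
      rw [variableChange_c₄, map_mul, hc, mul_one, map_pow,
        pow_le_one_iff (by norm_num)] at h
      rw [variableChange_Δ, map_mul, map_pow]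
      exact mul_le_of_le_one_left' (pow_le_one' h 12) with
    badReduction := hΔ
    multiplicativeReduction := hc }

end Reduction

/-! ### Reduction at a finite place of a number field -/

section NumberFieldReduction

open WeierstrassCurve

variable {K : Type u} [Field K] [NumberField K] (E : WeierstrassCurve K)
  (v : HeightOneSpectrum (𝓞 K))

lemma baseChange_self {F : Type*} [Field F] (W : WeierstrassCurve F) : W.baseChange F = W :=
  W.map_id

lemma valuation_adicCompletion_lt_one_iff (x : K) :
    (IsDiscreteValuationRing.maximalIdeal (v.adicCompletionIntegers K)).valuation
      (v.adicCompletion K) (algebraMap K (v.adicCompletion K) x) < 1 ↔ v.valuation K x < 1 :=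
  map_valuation_lt_one_iff _ _ _ (valuation_adicCompletion_le_one_iff v) x

lemma valuation_adicCompletion_eq_one_iff (x : K) :
    (IsDiscreteValuationRing.maximalIdeal (v.adicCompletionIntegers K)).valuation
      (v.adicCompletion K) (algebraMap K (v.adicCompletion K) x) = 1 ↔ v.valuation K x = 1 :=
  map_valuation_eq_one_iff _ _ _ (valuation_adicCompletion_le_one_iff v) x

variable {E v}

lemma HasGoodReductionAt.valuation_j_le_one (h : HasGoodReductionAt E v) :
    v.valuation K (E.c₄ ^ 3 / E.Δ) ≤ 1 := by
  obtain ⟨C, hC⟩ := h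
  have := valuation_j_le_one_of_hasGoodReduction _ _ hC
  rw [variableChange_c₄_cube_div_Δ, baseChange, map_c₄, map_Δ, ← map_pow, ← map_div₀] at this
  exact (valuation_adicCompletion_le_one_iff v _).1 this

lemma HasMultiplicativeReductionAt.one_lt_valuation_j (hE : E.Δ ≠ 0)
    (h : HasMultiplicativeReductionAt E v) :
    1 < v.valuation K (E.c₄ ^ 3 / E.Δ) := by
  obtain ⟨C, hC⟩ := h
  have := one_lt_valuation_j_of_hasMultiplicativeReduction _ _ ?_ hC
  · rw [variableChange_c₄_cube_div_Δ, baseChange, map_c₄, map_Δ, ← map_pow, ← map_div₀,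
      ← not_le, valuation_adicCompletion_le_one_iff, not_le] at this
    exact this
  · rw [variableChange_Δ, baseChange, map_Δ]
    exact mul_ne_zero (pow_ne_zero _ (Units.ne_zero _)) ((map_ne_zero _).2 hE)

lemma HasPotentiallyGoodReductionAt.valuation_j_le_one (h : HasPotentiallyGoodReductionAt E v) :
    v.valuation K (E.c₄ ^ 3 / E.Δ) ≤ 1 := by
  obtain ⟨L, _, _, _, w, hw, h⟩ := h
  have := h.valuation_j_le_one
  rw [baseChange, map_c₄, map_Δ, ← map_pow, ← map_div₀] at this
  exact (valuation_algebraMap_le_one_iff v w _).1 this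

lemma HasPotentiallyMultiplicativeReductionAt.one_lt_valuation_j (hE : E.Δ ≠ 0)
    (h : HasPotentiallyMultiplicativeReductionAt E v) :
    1 < v.valuation K (E.c₄ ^ 3 / E.Δ) := by
  obtain ⟨L, _, _, _, w, hw, h⟩ := h
  have := h.one_lt_valuation_j (by rw [baseChange, map_Δ]; exact (map_ne_zero _).2 hE)
  rw [baseChange, map_c₄, map_Δ, ← map_pow, ← map_div₀] at this
  rw [← not_le, ← valuation_algebraMap_le_one_iff v w, not_le]
  exact this

lemma HasGoodReductionAt.hasPotentiallyGoodReductionAt (h : HasGoodReductionAt E v) :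
    HasPotentiallyGoodReductionAt E v :=
  ⟨K, _, _, Algebra.id K, v, Ideal.LiesOver.mk (by exact (Ideal.comap_id _).symm), by rwa [baseChange_self]⟩

lemma HasMultiplicativeReductionAt.hasPotentiallyMultiplicativeReductionAt
    (h : HasMultiplicativeReductionAt E v) : HasPotentiallyMultiplicativeReductionAt E v :=
  ⟨K, _, _, Algebra.id K, v, Ideal.LiesOver.mk (by exact (Ideal.comap_id _).symm), by rwa [baseChange_self]⟩

lemma isIntegral_baseChange_adicCompletion (h₁ : v.valuation K E.a₁ ≤ 1)
    (h₂ : v.valuation K E.a₂ ≤ 1) (h₃ : v.valuation K E.a₃ ≤ 1)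
    (h₄ : v.valuation K E.a₄ ≤ 1) (h₆ : v.valuation K E.a₆ ≤ 1) :
    (E.baseChange (v.adicCompletion K)).IsIntegral (v.adicCompletionIntegers K) := by
  have key {x : K} (hx : v.valuation K x ≤ 1) : ∃ r : v.adicCompletionIntegers K,
      algebraMap _ (v.adicCompletion K) r = algebraMap K (v.adicCompletion K) x :=
    (valuation_maximalIdeal_le_one_iff _ _).1 ((valuation_adicCompletion_le_one_iff v x).2 hx)
  exact isIntegral_of_exists_lift _ (key h₁) (key h₂) (key h₃) (key h₄) (key h₆)

lemma hasGoodReductionAt_of_valuation_Δ_eq_one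
    (h : (E.baseChange (v.adicCompletion K)).IsIntegral (v.adicCompletionIntegers K))
    (hΔ : v.valuation K E.Δ = 1) : HasGoodReductionAt E v := by
  refine ⟨1, ?_⟩
  rw [one_smul]
  apply hasGoodReduction_of_valuation_Δ_eq_one
  rw [baseChange, map_Δ]
  exact (valuation_adicCompletion_eq_one_iff v _).2 hΔ

lemma hasMultiplicativeReductionAt_of_valuation_c₄_eq_one
    (h : (E.baseChange (v.adicCompletion K)).IsIntegral (v.adicCompletionIntegers K))
    (hΔ : v.valuation K E.Δ < 1) (hc : v.valuation K E.c₄ = 1) :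
    HasMultiplicativeReductionAt E v := by
  refine ⟨1, ?_⟩
  rw [one_smul]
  apply hasMultiplicativeReduction_of_valuation_c₄_eq_one
  · rw [baseChange, map_Δ]
    exact (valuation_adicCompletion_lt_one_iff v _).2 hΔ
  · rw [baseChange, map_c₄]
    exact (valuation_adicCompletion_eq_one_iff v _).2 hc

lemma HasMultiplicativeReductionAt.not_hasGoodReductionAt (hE : E.Δ ≠ 0)
    (h : HasMultiplicativeReductionAt E v) : ¬ HasGoodReductionAt E v :=
  fun h' ↦ h'.valuation_j_le_one.not_gt (h.one_lt_valuation_j hE)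

end NumberFieldReduction

/-! ### Curves of prime conductor -/

section Conductor

variable {R : Type*} [CommRing R] [IsDedekindDomain R]

/-- Every factor divides the maximal ideal `P`, so no other prime can occur. -/
lemma finprod_asIdeal_pow_eq_asIdeal_iff (P : HeightOneSpectrum R) (e : HeightOneSpectrum R → ℕ) :
    ∏ᶠ v, v.asIdeal ^ e v = P.asIdeal ↔ e P = 1 ∧ ∀ v ≠ P, e v = 0 := by
  constructor
  · intro h
    have hP1 : P.asIdeal ≠ 1 := by
      rw [Ideal.one_eq_top]
      exact P.isPrime.ne_top
    -- An infinite support would give `finprod` its default value 1, which is not `P`.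
    have hfin : (Function.mulSupport fun v : HeightOneSpectrum R ↦ v.asIdeal ^ e v).Finite := by
      by_contra hinf
      exact hP1 (h ▸ finprod_of_infinite_mulSupport hinf)
    have hdvd (v : HeightOneSpectrum R) : v.asIdeal ^ e v ∣ P.asIdeal := by
      by_cases hv : v.asIdeal ^ e v = 1
      · rw [hv]
        exact one_dvd _
      · rw [← h, finprod_eq_prod _ hfin]
        exact Finset.dvd_prod_of_mem _ (hfin.mem_toFinset.2 hv)
    have hne (v : HeightOneSpectrum R) (hv : v ≠ P) : e v = 0 := by
      by_contra hev
      have h1 : P.asIdeal ≤ v.asIdeal := Ideal.le_of_dvd ((dvd_pow_self _ hev).trans (hdvd v))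
      exact hv (HeightOneSpectrum.ext (P.isMaximal.eq_of_le v.isPrime.ne_top h1).symm)
    refine ⟨?_, hne⟩
    rw [finprod_eq_single _ P fun v hv ↦ by rw [hne v hv, pow_zero]] at h
    exact (Ideal.pow_right_strictAnti P.asIdeal P.ne_bot P.isPrime.ne_top).injective
      (h.trans (pow_one _).symm)
  · rintro ⟨h1, h0⟩
    rw [finprod_eq_single _ P fun v hv ↦ by rw [h0 v hv, pow_zero], h1, pow_one]

variable {K : Type u} [Field K] [NumberField K] {E : WeierstrassCurve K}
  {v : HeightOneSpectrum (𝓞 K)}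

lemma conductorExponent_eq_zero_iff : conductorExponent E v = 0 ↔ HasGoodReductionAt E v := by
  unfold conductorExponent
  split_ifs <;> simp_all

lemma conductorExponent_eq_one_iff : conductorExponent E v = 1 ↔
    ¬ HasGoodReductionAt E v ∧ HasMultiplicativeReductionAt E v := by
  unfold conductorExponent
  split_ifs <;> simp_all
  omega

lemma conductor_eq_asIdeal_iff (P : HeightOneSpectrum (𝓞 K)) (hE : E.Δ ≠ 0) :
    conductor E = P.asIdeal ↔
      HasMultiplicativeReductionAt E P ∧ ∀ v ≠ P, HasGoodReductionAt E v := by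
  rw [conductor, finprod_asIdeal_pow_eq_asIdeal_iff, conductorExponent_eq_one_iff,
    and_iff_right_of_imp (a := ¬ _)
      fun h : HasMultiplicativeReductionAt E P ↦ h.not_hasGoodReductionAt hE]
  simp only [conductorExponent_eq_zero_iff]

end Conductor

/-! ### Full two-torsion -/

section TwoTorsion

open WeierstrassCurve

section Field

variable {F : Type*} [Field F] (W : WeierstrassCurve F)

lemma two_nsmul_some_eq_zero_iff [DecidableEq F] {x y : F} (h : W.toAffine.Nonsingular x y) :
    2 • Affine.Point.some x y h = 0 ↔ 2 * y + W.a₁ * x + W.a₃ = 0 := by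
  rw [two_nsmul, add_eq_zero_iff_eq_neg, Affine.Point.neg_some, Affine.Point.some.injEq,
    and_iff_right rfl, Affine.negY]
  constructor <;> intro h <;> linear_combination h

/-- Completing the square: four times the equation reads `(2y + a₁x + a₃)² = 4x³ + b₂x² + 2b₄x +
b₆`. -/
lemma four_mul_equation {x y : F} (h2 : (2 : F) ≠ 0) (hy : 2 * y + W.a₁ * x + W.a₃ = 0) :
    W.toAffine.Equation x y ↔ 4 * x ^ 3 + W.b₂ * x ^ 2 + 2 * W.b₄ * x + W.b₆ = 0 := by
  have h4 : (4 : F) ≠ 0 := by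
    rw [show (4 : F) = 2 * 2 by norm_num]
    exact mul_ne_zero h2 h2
  rw [Affine.equation_iff', ← mul_right_inj' h4, mul_zero, ← neg_eq_zero, b₂, b₄, b₆]
  have : -(4 * (y ^ 2 + W.a₁ * x * y + W.a₃ * y - (x ^ 3 + W.a₂ * x ^ 2 + W.a₄ * x + W.a₆))) =
      4 * x ^ 3 + (W.a₁ ^ 2 + 4 * W.a₂) * x ^ 2 + 2 * (2 * W.a₄ + W.a₁ * W.a₃) * x +
        (W.a₃ ^ 2 + 4 * W.a₆) := by
    linear_combination (-(2 * y + W.a₁ * x + W.a₃)) * hy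
  rw [this]

end Field

variable {K : Type u} [Field K] [CharZero K] (E : WeierstrassCurve K)

/-- At a nonzero 2-torsion point `y` is determined linearly by `x`, so rationality only has to be
tested on `x`. -/
lemma hasFullTwoTorsion_iff (hE : E.Δ ≠ 0) : HasFullTwoTorsion E ↔
    ∀ x : AlgebraicClosure K,
      4 * x ^ 3 + algebraMap K _ E.b₂ * x ^ 2 + 2 * algebraMap K _ E.b₄ * x +
        algebraMap K _ E.b₆ = 0 → ∃ t : K, algebraMap K _ t = x := by
  have h2 : (2 : AlgebraicClosure K) ≠ 0 := two_ne_zero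
  set W := E.baseChange (AlgebraicClosure K) with hW
  have ha₁ : algebraMap K _ E.a₁ = W.a₁ := rfl
  have ha₃ : algebraMap K _ E.a₃ = W.a₃ := rfl
  have hb₂ : algebraMap K _ E.b₂ = W.b₂ := (E.map_b₂ _).symm
  have hb₄ : algebraMap K _ E.b₄ = W.b₄ := (E.map_b₄ _).symm
  have hb₆ : algebraMap K _ E.b₆ = W.b₆ := (E.map_b₆ _).symm
  have hΔ : W.Δ ≠ 0 := by
    rw [hW, baseChange, map_Δ]
    exact (map_ne_zero _).2 hE
  rw [hb₂, hb₄, hb₆]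
  classical
  constructor
  · intro h x hx
    obtain ⟨y, hy⟩ : ∃ y, 2 * y + W.a₁ * x + W.a₃ = 0 :=
      ⟨-(W.a₁ * x + W.a₃) / 2, by field_simp; ring⟩
    have hns := (W.toAffine.equation_iff_nonsingular_of_Δ_ne_zero hΔ).1
      ((four_mul_equation W h2 hy).2 hx)
    obtain ⟨Q, hQ⟩ := h (.some x y hns) (by convert (two_nsmul_some_eq_zero_iff W hns).2 hy)
    rcases Q with _ | ⟨x', y', h'⟩
    · cases hQ
    · rw [Affine.Point.map_some, Affine.Point.some.injEq] at hQ
      exact ⟨x', hQ.1⟩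
  · intro h Q hQ
    rcases Q with _ | ⟨x, y, hns⟩
    · exact ⟨0, rfl⟩
    · have hy : 2 * y + W.a₁ * x + W.a₃ = 0 :=
        (two_nsmul_some_eq_zero_iff W hns).1 (by convert hQ)
      obtain ⟨t, rfl⟩ := h x ((four_mul_equation W h2 hy).1 hns.1)
      obtain ⟨s, rfl⟩ : ∃ s, algebraMap K (AlgebraicClosure K) s = y := by
        refine ⟨-(E.a₁ * t + E.a₃) / 2, ?_⟩
        simp only [map_div₀, map_neg, map_add, map_mul, map_ofNat, ha₁, ha₃]
        field_simp
        linear_combination -hy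
      exact ⟨.some t s ((Affine.baseChange_nonsingular E
        (Algebra.ofId K (AlgebraicClosure K)).injective t s).1 hns), rfl⟩

lemma HasFullTwoTorsion.exists_roots (hE : E.Δ ≠ 0) (h : HasFullTwoTorsion E) :
    ∃ e₁ e₂ e₃ : K, E.b₂ = -4 * (e₁ + e₂ + e₃) ∧
      2 * E.b₄ = 4 * (e₁ * e₂ + e₁ * e₃ + e₂ * e₃) ∧ E.b₆ = -4 * (e₁ * e₂ * e₃) := by
  rw [hasFullTwoTorsion_iff E hE] at h
  have ha : E.twoTorsionPolynomial.a ≠ 0 := show (4 : K) ≠ 0 by norm_num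
  obtain ⟨x, y, z, hr⟩ := (Cubic.splits_iff_roots_eq_three
    (φ := algebraMap K (AlgebraicClosure K)) ha).1 (IsAlgClosed.splits _)
  have h0 : (E.twoTorsionPolynomial.map (algebraMap K (AlgebraicClosure K))).toPoly ≠ 0 :=
    Cubic.ne_zero_of_a_ne_zero ((map_ne_zero _).2 ha)
  have hroot (t : AlgebraicClosure K) (ht : t ∈ ({x, y, z} : Multiset (AlgebraicClosure K))) :
      ∃ s : K, algebraMap K _ s = t := by
    rw [← hr, Cubic.mem_roots_iff h0] at ht
    refine h t ?_
    simpa only [Cubic.map, twoTorsionPolynomial, map_mul,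
      map_ofNat (algebraMap K (AlgebraicClosure K))] using ht
  obtain ⟨e₁, rfl⟩ := hroot x (by simp)
  obtain ⟨e₂, rfl⟩ := hroot y (by simp)
  obtain ⟨e₃, rfl⟩ := hroot z (by simp)
  have hb := Cubic.b_eq_three_roots ha hr
  have hc := Cubic.c_eq_three_roots ha hr
  have hd := Cubic.d_eq_three_roots ha hr
  simp only [← map_add, ← map_mul, ← map_neg] at hb hc hd
  have inj := (algebraMap K (AlgebraicClosure K)).injective
  replace hb := inj hb
  replace hc := inj hc
  replace hd := inj hd
  simp only [twoTorsionPolynomial] at hb hc hd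
  exact ⟨e₁, e₂, e₃, by linear_combination hb, by linear_combination hc, by linear_combination hd⟩

/-- The classical formula for the `j`-invariant in terms of the Legendre parameter. -/
lemma HasFullTwoTorsion.exists_legendre (hE : E.Δ ≠ 0) (h : HasFullTwoTorsion E) :
    ∃ l : K, l ≠ 0 ∧ 1 - l ≠ 0 ∧
      E.c₄ ^ 3 / E.Δ * (l ^ 2 * (1 - l) ^ 2) = 2 ^ 8 * (l ^ 2 - l + 1) ^ 3 := by
  obtain ⟨e₁, e₂, e₃, h₂, h₄, h₆⟩ := exists_roots E hE h
  have h₄' : E.b₄ = 2 * (e₁ * e₂ + e₁ * e₃ + e₂ * e₃) :=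
    mul_left_cancel₀ (two_ne_zero (α := K)) (by linear_combination h₄)
  have h₈ : E.b₈ = 4 * e₁ * e₂ * e₃ * (e₁ + e₂ + e₃) - (e₁ * e₂ + e₁ * e₃ + e₂ * e₃) ^ 2 := by
    refine mul_left_cancel₀ (show (4 : K) ≠ 0 by norm_num) ?_
    rw [E.b_relation, h₂, h₄', h₆]
    ring
  have hΔ : E.Δ = 16 * ((e₂ - e₁) ^ 2 * (e₃ - e₁) ^ 2 * (e₂ - e₃) ^ 2) := by
    rw [Δ, h₂, h₄', h₆, h₈]
    ring
  have hc : E.c₄ = 16 * ((e₃ - e₁) ^ 2 - (e₃ - e₁) * (e₂ - e₁) + (e₂ - e₁) ^ 2) := by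
    rw [c₄, h₂, h₄']
    ring
  have h21 : e₂ - e₁ ≠ 0 := by rintro h; simp [hΔ, h] at hE
  have h31 : e₃ - e₁ ≠ 0 := by rintro h; simp [hΔ, h] at hE
  have h23 : e₂ - e₃ ≠ 0 := by rintro h; simp [hΔ, h] at hE
  have hl : 1 - (e₃ - e₁) / (e₂ - e₁) = (e₂ - e₃) / (e₂ - e₁) := by
    field_simp
    ring
  -- The image of `e₃` under the affine map sending `e₁` to 0 and `e₂` to 1.
  refine ⟨(e₃ - e₁) / (e₂ - e₁), div_ne_zero h31 h21, hl ▸ div_ne_zero h23 h21, ?_⟩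
  rw [hl, hΔ, hc]
  field_simp
  ring

end TwoTorsion

/-! ### The Legendre parameter and the `j`-invariant -/

section Legendre

variable {F : Type*} [Field F] {Γ : Type*} [LinearOrderedCommGroupWithZero Γ] (w : Valuation F Γ)

/-- Together with `l ↦ l⁻¹`, this generates the six-element symmetry group of the Legendre
parameter, which reduces every estimate to the case of large `l`. -/
lemma legendre_one_sub {j l : F} (hj : j * (l ^ 2 * (1 - l) ^ 2) = 2 ^ 8 * (l ^ 2 - l + 1) ^ 3) :
    j * ((1 - l) ^ 2 * (1 - (1 - l)) ^ 2) = 2 ^ 8 * ((1 - l) ^ 2 - (1 - l) + 1) ^ 3 := by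
  linear_combination hj

lemma legendre_inv {j l : F} (hl : l ≠ 0)
    (hj : j * (l ^ 2 * (1 - l) ^ 2) = 2 ^ 8 * (l ^ 2 - l + 1) ^ 3) :
    j * (l⁻¹ ^ 2 * (1 - l⁻¹) ^ 2) = 2 ^ 8 * (l⁻¹ ^ 2 - l⁻¹ + 1) ^ 3 := by
  have h1 : l⁻¹ ^ 2 * (1 - l⁻¹) ^ 2 = (l ^ 2 * (1 - l) ^ 2) * l⁻¹ ^ 6 := by
    field_simp
    ring
  have h2 : (l⁻¹ ^ 2 - l⁻¹ + 1) ^ 3 = (l ^ 2 - l + 1) ^ 3 * l⁻¹ ^ 6 := by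
    field_simp
    ring
  rw [h1, h2, ← mul_assoc, hj, mul_assoc]

lemma valuation_one_sub_of_lt {l : F} (h : w l < 1) : w (1 - l) = 1 := by
  rw [Valuation.map_one_sub_of_lt w h]

/-- For large `l` the `j`-invariant has the size of `2 ^ 8 * l ^ 2`. -/
lemma valuation_j_of_one_lt {j l : F} (h : 1 < w l)
    (hj : j * (l ^ 2 * (1 - l) ^ 2) = 2 ^ 8 * (l ^ 2 - l + 1) ^ 3) :
    w j = (w 2 ^ 4 * w l) ^ 2 := by
  have hl : w l ≠ 0 := (zero_lt_one.trans h).ne'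
  have h1 : w (1 - l) = w l := by
    rw [Valuation.map_sub_swap, Valuation.map_sub_eq_of_lt_left]
    rwa [map_one]
  have h2 : w (l ^ 2 - l + 1) = w l ^ 2 := by
    have h3 : w (l - 1) < w (l ^ 2) := by
      rw [Valuation.map_sub_swap, h1, map_pow]
      exact lt_self_pow₀ h one_lt_two
    rw [show l ^ 2 - l + 1 = l ^ 2 - (l - 1) by ring, Valuation.map_sub_eq_of_lt_left _ h3, map_pow]
  have := congrArg w hj
  simp only [map_mul, map_pow, h1, h2] at this
  refine mul_right_cancel₀ (pow_ne_zero 4 hl) ?_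
  calc w j * w l ^ 4 = w j * (w l ^ 2 * w l ^ 2) := by rw [← pow_add]
    _ = _ := this
    _ = _ := by simp only [mul_pow, ← pow_mul, mul_assoc, ← pow_add]

lemma valuation_legendre_le_one {j l : F} (h2 : w 2 = 1) (hj1 : w j ≤ 1)
    (hj : j * (l ^ 2 * (1 - l) ^ 2) = 2 ^ 8 * (l ^ 2 - l + 1) ^ 3) : w l ≤ 1 := by
  by_contra! h
  rw [valuation_j_of_one_lt w h hj, h2, one_pow, one_mul] at hj1
  exact hj1.not_gt (one_lt_pow₀ h two_ne_zero)

lemma valuation_legendre_eq_one {j l : F} (hl : l ≠ 0) (h2 : w 2 = 1) (hj1 : w j ≤ 1)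
    (hj : j * (l ^ 2 * (1 - l) ^ 2) = 2 ^ 8 * (l ^ 2 - l + 1) ^ 3) : w l = 1 := by
  refine le_antisymm (valuation_legendre_le_one w h2 hj1 hj) ?_
  have := valuation_legendre_le_one w h2 hj1 (legendre_inv hl hj)
  rwa [map_inv₀, inv_le_one₀ (zero_lt_iff.2 ((w.ne_zero_iff).2 hl))] at this

lemma one_lt_valuation_of_one_lt_legendre {j l : F} (h : 1 < w l) (hj1 : 1 < w j)
    (hj : j * (l ^ 2 * (1 - l) ^ 2) = 2 ^ 8 * (l ^ 2 - l + 1) ^ 3) : 1 < w 2 ^ 4 * w l := by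
  rw [valuation_j_of_one_lt w h hj] at hj1
  exact (one_lt_pow_iff_of_nonneg zero_le two_ne_zero).1 hj1

lemma valuation_lt_of_legendre_lt_one {j l : F} (hl : l ≠ 0) (h : w l < 1) (hj1 : 1 < w j)
    (hj : j * (l ^ 2 * (1 - l) ^ 2) = 2 ^ 8 * (l ^ 2 - l + 1) ^ 3) : w l < w 2 ^ 4 := by
  have hl' : 0 < w l := zero_lt_iff.2 ((w.ne_zero_iff).2 hl)
  have := one_lt_valuation_of_one_lt_legendre w (l := l⁻¹)
    (by rw [map_inv₀]; exact (one_lt_inv₀ hl').2 h) hj1 (legendre_inv hl hj)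
  rwa [map_inv₀, lt_mul_inv_iff₀ hl', one_mul] at this

/-- If the `j`-invariant is not integral, one of `l`, `1 - l`, `l⁻¹` is divisible by more
than `2 ^ 4`. -/
lemma legendre_trichotomy {j l : F} (hl : l ≠ 0) (hl1 : 1 - l ≠ 0) (h2 : w 2 ≤ 1) (hj1 : 1 < w j)
    (hj : j * (l ^ 2 * (1 - l) ^ 2) = 2 ^ 8 * (l ^ 2 - l + 1) ^ 3) :
    w l < w 2 ^ 4 ∨ w (1 - l) < w 2 ^ 4 ∨ w l⁻¹ < w 2 ^ 4 := by
  rcases lt_trichotomy (w l) 1 with h | h | h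
  · exact .inl (valuation_lt_of_legendre_lt_one w hl h hj1 hj)
  · have h1 : w (1 - l) ≤ 1 := (w.map_sub _ _).trans (by simp [h])
    rcases h1.lt_or_eq with h1 | h1
    · exact .inr (.inl (valuation_lt_of_legendre_lt_one w hl1 h1 hj1 (legendre_one_sub hj)))
    -- If `l` and `1 - l` are both units, the relation makes `j` integral, a contradiction.
    · have h3 : w (l ^ 2 - l + 1) ≤ 1 :=
        w.map_add_le (w.map_sub_le (by simp [h]) h.le) (map_one w).le
      have := congrArg w hj
      simp only [map_mul, map_pow, h, h1, one_pow, mul_one] at this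
      exact absurd (this ▸ mul_le_one' (pow_le_one' h2 8) (pow_le_one' h3 3)) hj1.not_ge
  · have hl' : 0 < w l := zero_lt_iff.2 ((w.ne_zero_iff).2 hl)
    have := one_lt_valuation_of_one_lt_legendre w h hj1 hj
    refine .inr (.inr ?_)
    rw [map_inv₀]
    exact (inv_lt_iff_one_lt_mul₀ hl').2 this

end Legendre

/-! ### The `S`-unit equation -/

section SUnit

variable {K : Type u} [Field K] [NumberField K] {P : HeightOneSpectrum (𝓞 K)}

/-- The sign in `ordAt` reverses the order; nonvanishing matters because the logarithm of 0 is 0 by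
convention. -/
lemma lt_ordAt_iff {x y : K} (hx : x ≠ 0) (hy : y ≠ 0) (n : ℕ) :
    n * ordAt P y < ordAt P x ↔ P.valuation K x < P.valuation K y ^ n := by
  have hx' : P.valuation K x ≠ 0 := ((P.valuation K).ne_zero_iff).2 hx
  have hy' : P.valuation K y ≠ 0 := ((P.valuation K).ne_zero_iff).2 hy
  rw [← WithZero.log_lt_log hx' (pow_ne_zero n hy'), WithZero.log_pow, ordAt, ordAt, nsmul_eq_mul,
    mul_neg, neg_lt_neg_iff]

lemma ordAt_inv (x : K) : ordAt P x⁻¹ = -ordAt P x := by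
  rw [ordAt, ordAt, map_inv₀, WithZero.log_inv]

lemma ordAt_eq_zero {x : K} (hx : P.valuation K x = 1) : ordAt P x = 0 := by
  rw [ordAt, hx, WithZero.log_one, neg_zero]

lemma valuation_two_eq_one (hP : {v : HeightOneSpectrum (𝓞 K) | (2 : 𝓞 K) ∈ v.asIdeal} = {P})
    {v : HeightOneSpectrum (𝓞 K)} (hv : v ≠ P) : v.valuation K 2 = 1 := by
  rw [← map_ofNat (algebraMap (𝓞 K) K) 2, HeightOneSpectrum.valuation_eq_one_iff_notMem]
  intro h
  have : v ∈ ({P} : Set (HeightOneSpectrum (𝓞 K))) := hP ▸ h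
  exact hv this

lemma valuation_two_lt_one (hP : {v : HeightOneSpectrum (𝓞 K) | (2 : 𝓞 K) ∈ v.asIdeal} = {P}) :
    P.valuation K 2 < 1 := by
  rw [← map_ofNat (algebraMap (𝓞 K) K) 2, HeightOneSpectrum.valuation_lt_one_iff_mem]
  have : P ∈ {v : HeightOneSpectrum (𝓞 K) | (2 : 𝓞 K) ∈ v.asIdeal} := hP ▸ rfl
  exact this

variable {S : Set (HeightOneSpectrum (𝓞 K))} {x y : Kˣ}

lemma IsSUnitSolution.symm (h : IsSUnitSolution S x y) : IsSUnitSolution S y x :=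
  ⟨h.2.1, h.1, by rw [add_comm]; exact h.2.2⟩

/-- Division of `x + y = 1` by `x`. -/
lemma IsSUnitSolution.inv (h : IsSUnitSolution S x y) :
    IsSUnitSolution S x⁻¹ (-y * x⁻¹) := by
  refine ⟨inv_mem h.1, mul_mem (fun v hv ↦ ?_) (inv_mem h.1), ?_⟩
  · rw [Units.val_neg, Valuation.map_neg]
    exact h.2.1 v hv
  · have := h.2.2
    rw [Units.val_mul, Units.val_neg, Units.val_inv_eq_inv_val]
    field_simp
    linear_combination -this

lemma IsSUnitSolution.valuation_right (h : IsSUnitSolution S x y)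
    (hx : P.valuation K (x : K) < 1) : P.valuation K (y : K) = 1 := by
  rw [← valuation_one_sub_of_lt _ hx, eq_sub_of_add_eq' h.2.2]

lemma IsSUnitSolution.ordAt_right (h : IsSUnitSolution S x y)
    (hx : P.valuation K (x : K) < 1) : ordAt P (y : K) = 0 :=
  ordAt_eq_zero (h.valuation_right hx)

end SUnit

/-! ### The curve attached to a solution -/

section FreyCurve

open WeierstrassCurve

/-- The Weierstrass curve `y² + xy = x³ + (l/4)x² + (l/16)x`, a model of `Y² = X(X + 1)(X + l)`. -/
def freyCurve {F : Type*} [Field F] (l : F) : WeierstrassCurve F :=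
  ⟨1, l / 4, 0, l / 16, 0⟩

variable {K : Type u} [Field K] [CharZero K] (l : K)

lemma freyCurve_c₄ : (freyCurve l).c₄ = l ^ 2 - l + 1 := by
  simp only [c₄, b₂, b₄, freyCurve]
  field_simp
  ring

lemma freyCurve_Δ : (freyCurve l).Δ = l ^ 2 * (1 - l) ^ 2 / 2 ^ 8 := by
  simp only [Δ, b₂, b₄, b₆, b₈, freyCurve]
  field_simp
  ring

variable {l}

lemma freyCurve_Δ_ne_zero (hl : l ≠ 0) (hl1 : 1 - l ≠ 0) : (freyCurve l).Δ ≠ 0 := by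
  rw [freyCurve_Δ]
  exact div_ne_zero (mul_ne_zero (pow_ne_zero 2 hl) (pow_ne_zero 2 hl1)) (by norm_num)

/-- Four times the 2-division polynomial is `x (4x + 1) (4x + l)`, with roots `0`, `-1/4`, `-l/4`.
-/
lemma freyCurve_hasFullTwoTorsion (hl : l ≠ 0) (hl1 : 1 - l ≠ 0) :
    HasFullTwoTorsion (freyCurve l) := by
  rw [hasFullTwoTorsion_iff _ (freyCurve_Δ_ne_zero hl hl1)]
  intro x hx
  have h2 : (2 : AlgebraicClosure K) ≠ 0 := two_ne_zero
  have hx' : x * (4 * x + 1) * (4 * x + algebraMap K _ l) = 0 := by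
    simp only [b₂, b₄, b₆, freyCurve, map_add, map_mul, map_div₀, map_pow, map_one, map_zero,
      map_ofNat (algebraMap K (AlgebraicClosure K))] at hx
    field_simp at hx
    linear_combination hx / 4
  rcases mul_eq_zero.1 hx' with h | h
  · rcases mul_eq_zero.1 h with h | h
    · exact ⟨0, by rw [h, map_zero]⟩
    · refine ⟨-1 / 4, ?_⟩
      rw [map_div₀, map_neg, map_one, map_ofNat]
      field_simp
      linear_combination -h
  · refine ⟨-l / 4, ?_⟩
    rw [map_div₀, map_neg, map_ofNat]
    field_simp
    linear_combination -h

end FreyCurve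

/-! ### Reduction of the attached curve at the finite places -/

section FreyReduction

variable {K : Type u} [Field K] [NumberField K] {l : K} {v : HeightOneSpectrum (𝓞 K)}

open WeierstrassCurve

/-- The substitution `X = 4x`, `Y = 8y + 4x` removes `2¹²` from the discriminant of `Y² = X(X + 1)(X
+ l)`; the denominators 4 and 16 it creates are absorbed when 16 divides `l` locally. -/
lemma freyCurve_isIntegral (h : v.valuation K l ≤ v.valuation K 2 ^ 4) :
    ((freyCurve l).baseChange (v.adicCompletion K)).IsIntegral (v.adicCompletionIntegers K) := by
  have h2 : v.valuation K 2 ≤ 1 := by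
    rw [← map_ofNat (algebraMap (𝓞 K) K) 2]
    exact v.valuation_le_one _
  have h2' : 0 < v.valuation K 2 := zero_lt_iff.2 (((v.valuation K).ne_zero_iff).2 two_ne_zero)
  apply isIntegral_baseChange_adicCompletion
  · exact (map_one _).le
  · change v.valuation K (l / 4) ≤ 1
    rw [map_div₀, show (4 : K) = 2 ^ 2 by norm_num, map_pow, div_le_one₀ (pow_pos h2' 2)]
    exact h.trans (pow_le_pow_right_of_le_one' h2 (by norm_num))
  · exact (map_zero _).trans_le zero_le_one
  · change v.valuation K (l / 16) ≤ 1
    rw [map_div₀, show (16 : K) = 2 ^ 4 by norm_num, map_pow, div_le_one₀ (pow_pos h2' 4)]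
    exact h
  · exact (map_zero _).trans_le zero_le_one

lemma freyCurve_hasGoodReductionAt (h2 : v.valuation K 2 = 1) (hl : v.valuation K l = 1)
    (hl1 : v.valuation K (1 - l) = 1) : HasGoodReductionAt (freyCurve l) v := by
  refine hasGoodReductionAt_of_valuation_Δ_eq_one (freyCurve_isIntegral (by simp [h2, hl])) ?_
  rw [freyCurve_Δ, map_div₀, map_mul, map_pow, map_pow, map_pow, h2, hl, hl1]
  simp

/-- Since `l` is small, `c₄ = 1 - l(1 - l)` is a unit and `|Δ| = (|l| / |2|⁴)²`, so the strict bound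
on `l` is exactly what makes the reduction bad. -/
lemma freyCurve_hasMultiplicativeReductionAt (h2 : v.valuation K 2 < 1)
    (hl : v.valuation K l < v.valuation K 2 ^ 4) :
    HasMultiplicativeReductionAt (freyCurve l) v := by
  have h2' : 0 < v.valuation K 2 := zero_lt_iff.2 (((v.valuation K).ne_zero_iff).2 two_ne_zero)
  have hl1 : v.valuation K l < 1 := hl.trans (pow_lt_one₀ zero_le h2 (by norm_num))
  refine hasMultiplicativeReductionAt_of_valuation_c₄_eq_one (freyCurve_isIntegral hl.le) ?_ ?_
  · rw [freyCurve_Δ, map_div₀, map_mul, map_pow, map_pow, map_pow,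
      valuation_one_sub_of_lt _ hl1, one_pow, mul_one, div_lt_one₀ (pow_pos h2' 8),
      show 8 = 4 * 2 from rfl, pow_mul]
    exact pow_lt_pow_left₀ hl zero_le two_ne_zero
  · rw [freyCurve_c₄, show l ^ 2 - l + 1 = 1 - l * (1 - l) by ring]
    apply valuation_one_sub_of_lt
    rwa [map_mul, valuation_one_sub_of_lt _ hl1, mul_one]

end FreyReduction

/-! ### The implications between curves and solutions -/

section Equivalences

variable {K : Type u} [Field K] [NumberField K] {P : HeightOneSpectrum (𝓞 K)}
  (hP : {v : HeightOneSpectrum (𝓞 K) | (2 : 𝓞 K) ∈ v.asIdeal} = {P})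

include hP

lemma exists_isSUnitSolution_of_hasFullTwoTorsion {E : WeierstrassCurve K} (hE : E.Δ ≠ 0)
    (h : HasFullTwoTorsion E) (hgood : ∀ v ≠ P, HasPotentiallyGoodReductionAt E v)
    (hmult : HasPotentiallyMultiplicativeReductionAt E P) :
    ∃ x y : Kˣ, IsSUnitSolution {P} x y ∧
      max |ordAt P (x : K)| |ordAt P (y : K)| > 4 * ordAt P (2 : K) := by
  obtain ⟨l, hl, hl1, hj⟩ := h.exists_legendre E hE
  refine ⟨Units.mk0 l hl, Units.mk0 (1 - l) hl1, ⟨fun v hv ↦ ?_, fun v hv ↦ ?_, ?_⟩, ?_⟩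
  · exact valuation_legendre_eq_one _ hl (valuation_two_eq_one hP hv)
      (hgood v hv).valuation_j_le_one hj
  · exact valuation_legendre_eq_one _ hl1 (valuation_two_eq_one hP hv)
      (hgood v hv).valuation_j_le_one (legendre_one_sub hj)
  · exact add_sub_cancel l 1
  · have h4 {z : K} (hz : z ≠ 0) := lt_ordAt_iff (P := P) hz (two_ne_zero (α := K)) 4
    rw [gt_iff_lt, lt_max_iff, lt_abs, lt_abs, ← ordAt_inv]
    rcases legendre_trichotomy (P.valuation K) hl hl1 (valuation_two_lt_one hP).le
      (hmult.one_lt_valuation_j hE) hj with h | h | h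
    · exact .inl (.inl ((h4 hl).2 h))
    · exact .inr (.inl ((h4 hl1).2 h))
    -- Smallness of `l⁻¹` is the case of very negative `ord(l)`, covered by the absolute value.
    · exact .inl (.inr ((h4 (inv_ne_zero hl)).2 h))

lemma valuation_lt_one_of_lt_ordAt {x : Kˣ} (h : 4 * ordAt P (2 : K) < ordAt P (x : K)) :
    P.valuation K (x : K) < 1 :=
  ((lt_ordAt_iff x.ne_zero two_ne_zero 4).1 h).trans
    (pow_lt_one₀ zero_le (valuation_two_lt_one hP) (by norm_num))

lemma exists_isSUnitSolution_ordAt_eq_zero {x y : Kˣ} (h : IsSUnitSolution {P} x y)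
    (hmax : max |ordAt P (x : K)| |ordAt P (y : K)| > 4 * ordAt P (2 : K)) :
    ∃ x y : Kˣ, IsSUnitSolution {P} x y ∧ ordAt P (y : K) = 0 ∧
      ordAt P (x : K) > 4 * ordAt P (2 : K) := by
  have main {x y : Kˣ} (h : IsSUnitSolution {P} x y)
      (hx : 4 * ordAt P (2 : K) < ordAt P (x : K)) :
      ∃ x y : Kˣ, IsSUnitSolution {P} x y ∧ ordAt P (y : K) = 0 ∧
        ordAt P (x : K) > 4 * ordAt P (2 : K) :=
    ⟨x, y, h, h.ordAt_right (valuation_lt_one_of_lt_ordAt hP hx), hx⟩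
  rw [gt_iff_lt, lt_max_iff, lt_abs, lt_abs, ← ordAt_inv, ← ordAt_inv,
    ← Units.val_inv_eq_inv_val, ← Units.val_inv_eq_inv_val] at hmax
  -- Each sign of each order corresponds to one solution obtained by swapping and inverting, whose
  -- first entry is then highly divisible by `P`.
  rcases hmax with (hx | hx) | (hy | hy)
  · exact main h hx
  · exact main h.inv hx
  · exact main h.symm hy
  · exact main h.symm.inv hy

lemma exists_conductor_eq {x y : Kˣ} (h : IsSUnitSolution {P} x y)
    (hx : ordAt P (x : K) > 4 * ordAt P (2 : K)) :
    ∃ E : WeierstrassCurve K, E.IsElliptic ∧ HasFullTwoTorsion E ∧ conductor E = P.asIdeal := by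
  have hy : 1 - (x : K) = y := (eq_sub_of_add_eq' h.2.2).symm
  have hy0 : 1 - (x : K) ≠ 0 := hy ▸ y.ne_zero
  have hΔ := freyCurve_Δ_ne_zero x.ne_zero hy0
  refine ⟨freyCurve (x : K), ⟨isUnit_iff_ne_zero.2 hΔ⟩,
    freyCurve_hasFullTwoTorsion x.ne_zero hy0, (conductor_eq_asIdeal_iff P hΔ).2 ⟨?_, ?_⟩⟩
  · exact freyCurve_hasMultiplicativeReductionAt (valuation_two_lt_one hP)
      ((lt_ordAt_iff x.ne_zero two_ne_zero 4).1 hx)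
  · intro v hv
    exact freyCurve_hasGoodReductionAt (valuation_two_eq_one hP hv) (h.1 v hv)
      (hy ▸ h.2.1 v hv)

end Equivalences

end FermatTwist

theorem proposition4p3 {K : Type u} [Field K] [NumberField K]
    (P : HeightOneSpectrum (𝓞 K))
    (hP : {v : HeightOneSpectrum (𝓞 K) | (2 : 𝓞 K) ∈ v.asIdeal} = {P}) :
    List.TFAE [
      ∃ E : WeierstrassCurve K, E.IsElliptic ∧
        FermatTwist.HasFullTwoTorsion E ∧ FermatTwist.conductor E = P.asIdeal,
      ∃ E : WeierstrassCurve K, E.IsElliptic ∧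
        FermatTwist.HasFullTwoTorsion E ∧
        (∀ v : HeightOneSpectrum (𝓞 K), v ≠ P → FermatTwist.HasPotentiallyGoodReductionAt E v) ∧
        FermatTwist.HasPotentiallyMultiplicativeReductionAt E P,
      ∃ x y : Kˣ, FermatTwist.IsSUnitSolution {P} x y ∧
        FermatTwist.ordAt P (y : K) = 0 ∧
        FermatTwist.ordAt P (x : K) > 4 * FermatTwist.ordAt P (2 : K),
      ∃ x y : Kˣ, FermatTwist.IsSUnitSolution {P} x y ∧
        max |FermatTwist.ordAt P (x : K)| |FermatTwist.ordAt P (y : K)| >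
          4 * FermatTwist.ordAt P (2 : K)] := by
  tfae_have 1 → 2 := by
    rintro ⟨E, hE, h2, hc⟩
    obtain ⟨hP, hv⟩ := (FermatTwist.conductor_eq_asIdeal_iff P hE.isUnit.ne_zero).1 hc
    exact ⟨E, hE, h2, fun v hvP ↦ (hv v hvP).hasPotentiallyGoodReductionAt,
      hP.hasPotentiallyMultiplicativeReductionAt⟩
  tfae_have 2 → 4 := by
    rintro ⟨E, hE, h2, hgood, hmult⟩
    exact FermatTwist.exists_isSUnitSolution_of_hasFullTwoTorsion hP hE.isUnit.ne_zero h2 hgood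
      hmult
  tfae_have 4 → 3 := by
    rintro ⟨x, y, h, hmax⟩
    exact FermatTwist.exists_isSUnitSolution_ordAt_eq_zero hP h hmax
  tfae_have 3 → 1 := by
    rintro ⟨x, y, h, -, hx⟩
    exact FermatTwist.exists_conductor_eq hP h hx
  tfae_finish
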